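/- **Setting.** Let $\mathfrak h$ be a finite dimensional real vector space and $I$ a finite set. Let $(\mathfrak h,(H_i,L_i)_{i\in I})$ be a linear Coxeter system: $H_i=\mathbb R_{\ge 0}h_i\subseteq\mathfrak h$ and $L_i=\mathbb R_{\ge 0}\alpha_i\subseteq\mathfrak h^*$ are closed rays with generators normalised by $\alpha_i(h_i)=2$, such that * the cone $\overline C=\{\lambda\in\mathfrak h^*\mid \lambda(h_i)\ge 0 \text{ for all } i\in I\}$ spans $\mathfrak h^*$, and the sets $\overline C\cap\{\lambda\mid\lambda(h_i)=0\}$, $i\in I$, are pairwise different and are exactly the faces of codimension one of $\overline C$; * $\sigma C\cap C=\emptyset$ for all $\sigma\in W\setminus\{1\}$, where $C=\{\lambda\in\mathfrak h^*\mid \lambda(h_i)>0\text{ for all }i\in I\}$ and $W\subseteq GL(\mathfrak h^*)$ is the group generated by the reflections $\sigma_i(\lambda)=\lambda-\lambda(h_i)\alpha_i$, $i\in I$. For $J\subseteq I$ let $W_J=\langle\sigma_i\mid i\in J\rangle$. Let $X=\bigcup_{\sigma\in W}\sigma\overline C$ be the Tits cone, and let $Y\subseteq X$ be a $W$-invariant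 convex cone with $0\in Y$. A face of $Y$ is a nonempty face, i.e. a convex cone $0\in R\subseteq Y$ such that $x,y\in Y$ and $x+y\in R$ imply $x,y\in R$; $\mathrm{ri}(R)$ denotes its relative interior. Put $$\Upsilon=\{R \text{ a face of } Y\mid \mathrm{ri}(R)\cap\overline C\neq\emptyset\},$$ and for $R\in\Upsilon$ put $\upsilon(R)=\{i\in I\mid\sigma_iR=R\}$, $\upsilon_*(R)=\{i\in I\mid \sigma_i\lambda=\lambda\text{ for all }\lambda\in R\}$, $\upsilon^*(R)=\upsilon(R)\setminus\upsilon_*(R)$ and $N_W(R)=\{\sigma\in W\mid\sigma R=R\}$. **Theorem.** (a) For $R_1,R_2\in\Upsilon$ and $\sigma_1,\sigma_2\in W$ the following are equivalent: 1. $\sigma_1R_1\subseteq\sigma_2R_2$; 2. $R_1\subseteq R_2$ and $\sigma_1N_W(R_1)\cap\sigma_2N_W(R_2)\neq\emptyset$; 3. $R_1\subseteq R_2$ and $\sigma_1^{-1}\sigma_2\in N_W(R_1)N_W(R_2)$; 4. $R_1\subseteq R_2$ and $\sigma_1^{-1}\sigma_2\in W_{\upsilon_*(R_1)}W_{\upsilon^*(R_2)}$.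 (b) If $R_1,R_2\in\Upsilon$ and $R_1\subseteq R_2$, then $N_W(R_1)N_W(R_2)=W_{\upsilon_*(R_1)}W_{\upsilon^*(R_2)}$. (c) For every face $R'$ of $Y$ there is a unique $R\in\Upsilon$ such that $R'=\sigma R$ for some $\sigma\in W$. -/

import Mathlib

open Module Set
open scoped Pointwise

/-- The closed chamber `{l ∈ 𝔥* | l (h i) ≥ 0 for all i}`, as a convex cone with zero. -/
def closedChamber {ι 𝔥 : Type*} [AddCommGroup 𝔥] [Module ℝ 𝔥] (h : ι → 𝔥) :
    PointedCone ℝ (Dual ℝ 𝔥) :=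
  PointedCone.dual (Dual.eval ℝ 𝔥) (range h)

/-- The open chamber `{l ∈ 𝔥* | l (h i) > 0 for all i}`. -/
def openChamber {ι 𝔥 : Type*} [AddCommGroup 𝔥] [Module ℝ 𝔥] (h : ι → 𝔥) : Set (Dual ℝ 𝔥) :=
  {l | ∀ i, 0 < l (h i)}

theorem mem_closedChamber {ι 𝔥 : Type*} [AddCommGroup 𝔥] [Module ℝ 𝔥] (h : ι → 𝔥)
    (l : Dual ℝ 𝔥) : l ∈ closedChamber h ↔ ∀ i, 0 ≤ l (h i) := by
  simp [closedChamber, PointedCone.mem_dual]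

/-- The reflection `l ↦ l - l h • α` of `𝔥*`, where `α h = 2`. -/
def rayReflection {𝔥 : Type*} [AddCommGroup 𝔥] [Module ℝ 𝔥] (h : 𝔥) (α : Dual ℝ 𝔥)
    (hα : α h = 2) : Dual ℝ 𝔥 ≃ₗ[ℝ] Dual ℝ 𝔥 :=
  reflection (x := α) (f := Dual.eval ℝ 𝔥 h) hα

theorem rayReflection_apply {𝔥 : Type*} [AddCommGroup 𝔥] [Module ℝ 𝔥] (h : 𝔥) (α : Dual ℝ 𝔥)
    (hα : α h = 2) (l : Dual ℝ 𝔥) : rayReflection h α hα l = l - l h • α :=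
  reflection_apply (f := Dual.eval ℝ 𝔥 h) l hα

/-- A linear Coxeter system on a (finite dimensional) real vector space `𝔥`, together with
representatives of its rays: the rays are `H i = ℝ≥0 • coroot i ⊆ 𝔥` and
`L i = ℝ≥0 • root i ⊆ 𝔥*`, and the representatives are normalised by `root i (coroot i) = 2`,
which is possible because `L i` is positive on `H i` away from zero. The half spaces, the
chambers and the reflections depend only on the rays. -/
structure LinearCoxeterSystem (ι : Type*) (𝔥 : Type*) [AddCommGroup 𝔥] [Module ℝ 𝔥] where
  /-- A generator `h i` of the ray `H i`. -/
  coroot : ι → 𝔥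
  /-- A generator `α i` of the ray `L i`. -/
  root : ι → Dual ℝ 𝔥
  root_coroot_two : ∀ i, root i (coroot i) = 2
  /-- The closed chamber spans `𝔥*`. -/
  span_chamber : Submodule.span ℝ (closedChamber coroot : Set (Dual ℝ 𝔥)) = ⊤
  /-- The intersections of the closed chamber with the hyperplanes `l (h i) = 0` are pairwise
  different, and they are exactly the faces of codimension one of the closed chamber. -/
  bijOn_facets : BijOn
    (fun i => (closedChamber coroot : Set (Dual ℝ 𝔥)) ∩ {l : Dual ℝ 𝔥 | l (coroot i) = 0}) univ
    {S | ∃ F : PointedCone ℝ (Dual ℝ 𝔥), F.IsFaceOf (closedChamber coroot) ∧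
      (F : Set (Dual ℝ 𝔥)) = S ∧
      finrank ℝ (Submodule.span ℝ S) + 1 = finrank ℝ (Dual ℝ 𝔥)}
  /-- The nontrivial elements of the group generated by the reflections move the open chamber off
  itself. -/
  disjoint_smul : ∀ w ∈ Subgroup.closure
      (range fun i => rayReflection (coroot i) (root i) (root_coroot_two i)), w ≠ 1 →
    Disjoint (w • openChamber coroot) (openChamber coroot)

/-- The relative interior of a subset of a finite dimensional real vector space: its interior in
its affine hull, for the canonical topology of the space. -/
def relInterior {V : Type*} [AddCommGroup V] [Module ℝ V] (S : Set V) : Set V :=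
  letI : TopologicalSpace V := moduleTopology ℝ V
  intrinsicInterior ℝ S

namespace LinearCoxeterSystem

variable {ι 𝔥 : Type*} [AddCommGroup 𝔥] [Module ℝ 𝔥] (L : LinearCoxeterSystem ι 𝔥)

/-- The closed fundamental chamber. -/
def chamber : PointedCone ℝ (Dual ℝ 𝔥) :=
  closedChamber L.coroot

/-- The simple reflection `σ i : λ ↦ λ - λ (h i) • α i` of `𝔥*`. -/
def simple (i : ι) : Dual ℝ 𝔥 ≃ₗ[ℝ] Dual ℝ 𝔥 :=
  rayReflection (L.coroot i) (L.root i) (L.root_coroot_two i)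

/-- The standard parabolic subgroup `W_J`, generated by the `σ i` with `i ∈ J`. -/
def parabolic (J : Set ι) : Subgroup (Dual ℝ 𝔥 ≃ₗ[ℝ] Dual ℝ 𝔥) :=
  Subgroup.closure (L.simple '' J)

/-- The linear Coxeter group `W`, generated by all simple reflections. -/
def group : Subgroup (Dual ℝ 𝔥 ≃ₗ[ℝ] Dual ℝ 𝔥) :=
  Subgroup.closure (range L.simple)

/-- The Tits cone `X`, the union of the `W`-translates of the closed chamber. -/
def titsCone : Set (Dual ℝ 𝔥) :=
  ⋃ w ∈ L.group, w • (L.chamber : Set (Dual ℝ 𝔥))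

/-- The stabilizer `N_W(R)` of `R` as a whole, `{w ∈ W | w R = R}`. -/
def stabilizer (R : PointedCone ℝ (Dual ℝ 𝔥)) : Subgroup (Dual ℝ 𝔥 ≃ₗ[ℝ] Dual ℝ 𝔥) :=
  L.group ⊓ MulAction.stabilizer (Dual ℝ 𝔥 ≃ₗ[ℝ] Dual ℝ 𝔥) (R : Set (Dual ℝ 𝔥))

/-- The cross section lattice of `Y`: the nonempty faces of `Y` whose relative interior meets the
closed chamber. -/
def crossSection (Y : PointedCone ℝ (Dual ℝ 𝔥)) : Set (PointedCone ℝ (Dual ℝ 𝔥)) :=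
  {R | R.IsFaceOf Y ∧
    (relInterior (R : Set (Dual ℝ 𝔥)) ∩ (L.chamber : Set (Dual ℝ 𝔥))).Nonempty}

/-- The type map `υ(R)`: the `i` such that `σ i` maps `R` onto itself. -/
def typeMap (R : PointedCone ℝ (Dual ℝ 𝔥)) : Set ι :=
  {i | L.simple i • (R : Set (Dual ℝ 𝔥)) = R}

/-- The lower type map `υ_*(R)`: the `i` such that `σ i` fixes `R` pointwise. -/
def lowerType (R : PointedCone ℝ (Dual ℝ 𝔥)) : Set ι :=
  {i | ∀ l ∈ R, L.simple i l = l}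

/-- The upper type map `υ^*(R) = υ(R) \ υ_*(R)`: the `i` such that `σ i` maps `R` onto itself,
but does not fix it pointwise. -/
def upperType (R : PointedCone ℝ (Dual ℝ 𝔥)) : Set ι :=
  L.typeMap R \ L.lowerType R

end LinearCoxeterSystem

/-! Everything rests on one implication: if `R₁ ⊆ w R₂` with both faces in the cross section, then
`R₁ ≤ R₂` and `w ∈ W_{υ_*(R₁)} W_{υ^*(R₂)}` (`le_and_mem_parabolic_mul_of_subset_smul`). The rest of
(a) and (b) is formal, and (c) adds only that every point of `X` has a translate in the closed
chamber.

For the implication, pick `y` in the closed chamber, interior to `R₁`, lying only on walls that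
contain `R₁` (`exists_mem_algInterior_generic`). Then `w⁻¹ y ∈ R₂`. If `w⁻¹ y` is outside the
chamber, a ray starting at an interior chamber point of `R₂`, in direction `w⁻¹ y`, meets a wall
separating `C` from `w⁻¹ C`. The meeting point is still interior to `R₂` and fixed by the
reflection, which therefore preserves `R₂`. Reflecting shortens `w⁻¹`; by induction `w⁻¹` lies in
`W_{υ(R₂)}` times the stabilizer of `y` (`mem_and_mem_mul_of_apply_mem`), and this stabilizer lies
in `W_{υ_*(R₁)}`. Finally `W_{υ(R₂)}` factors into its commuting upper and lower parts, and the
lower part is absorbed since `υ_*(R₂) ⊆ υ_*(R₁)`.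

The Coxeter theory used (exchange condition, fundamental domain, parabolic stabilizers) is derived
geometrically from the facet and disjointness axioms. -/

/-! ### Relative interiors and faces of convex cones -/

section RelInterior

variable {V : Type*} [AddCommGroup V] [Module ℝ V]

/-- Linear equivalences carry relative interiors to relative interiors. -/
theorem relInterior_image {V' : Type*} [AddCommGroup V'] [Module ℝ V'] (e : V ≃ₗ[ℝ] V')
    (S : Set V) : relInterior (e '' S) = e '' relInterior S := by
  let : TopologicalSpace V := moduleTopology ℝ V
  let : TopologicalSpace V' := moduleTopology ℝ V'
  have : IsModuleTopology ℝ V := ⟨rfl⟩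
  have : IsModuleTopology ℝ V' := ⟨rfl⟩
  have := IsModuleTopology.toContinuousAdd ℝ V
  have := IsModuleTopology.toContinuousAdd ℝ V'
  have := IsModuleTopology.topologicalAddGroup ℝ V
  have := IsModuleTopology.topologicalAddGroup ℝ V'
  let f : V ≃L[ℝ] V' :=
    { e with
      continuous_toFun := IsModuleTopology.continuous_of_linearMap e.toLinearMap
      continuous_invFun := IsModuleTopology.continuous_of_linearMap e.symm.toLinearMap }
  exact f.toContinuousAffineEquiv.intrinsicInterior_image S

theorem Convex.relInterior_nonempty [FiniteDimensional ℝ V] {S : Set V} (hS : Convex ℝ S)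
    (hne : S.Nonempty) : (relInterior S).Nonempty := by
  let e : V ≃ₗ[ℝ] EuclideanSpace ℝ (Fin (finrank ℝ V)) :=
    LinearEquiv.ofFinrankEq _ _ (by simp)
  have h : (intrinsicInterior ℝ (e '' S)).Nonempty :=
    (hne.image e).intrinsicInterior (hS.linear_image e.toLinearMap)
  -- In finite dimension the norm topology is the module topology, so the normed-space result
  -- applies.
  have key : relInterior (e '' S) = intrinsicInterior ℝ (e '' S) := by
    have : IsModuleTopology ℝ (EuclideanSpace ℝ (Fin (finrank ℝ V))) :=
      isModuleTopologyOfFiniteDimensional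
    unfold relInterior
    rw [← eq_moduleTopology ℝ (EuclideanSpace ℝ (Fin (finrank ℝ V)))]
  rw [← key, relInterior_image] at h
  exact h.of_image

end RelInterior

namespace PointedCone

variable {V : Type*} [AddCommGroup V] [Module ℝ V] {R F Y : PointedCone ℝ V} {x y : V}

/-- The algebraic relative interior of a convex cone. -/
def algInterior (R : PointedCone ℝ V) : Set V :=
  {x | x ∈ R ∧ ∀ y ∈ R, ∃ ε : ℝ, 0 < ε ∧ x - ε • y ∈ R}

/-- Since `0` and `y` lie in `R`, the line `x - t • y` stays in the affine hull of `R`, hence in `R`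
for small `t`. The later arguments use relative interiors only through this property. -/
theorem relInterior_subset_algInterior (R : PointedCone ℝ V) :
    relInterior (R : Set V) ⊆ R.algInterior := by
  let : TopologicalSpace V := moduleTopology ℝ V
  have : IsModuleTopology ℝ V := ⟨rfl⟩
  have := IsModuleTopology.toContinuousAdd ℝ V
  have := IsModuleTopology.topologicalAddGroup ℝ V
  intro x hx
  have hxR : x ∈ R := intrinsicInterior_subset (𝕜 := ℝ) hx
  refine ⟨hxR, fun y hy => ?_⟩
  obtain ⟨z, hz, rfl⟩ := mem_intrinsicInterior.1 hx
  have hmem : ∀ t : ℝ, (z : V) - t • y ∈ affineSpan ℝ (R : Set V) := fun t => by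
    have := (affineSpan ℝ (R : Set V)).smul_vsub_vadd_mem t
      (subset_affineSpan ℝ _ R.zero_mem) (subset_affineSpan ℝ _ hy) z.2
    simpa [sub_eq_add_neg, add_comm] using this
  let f : ℝ → affineSpan ℝ (R : Set V) := fun t => ⟨z - t • y, hmem t⟩
  have hf : Continuous f := by
    refine Continuous.subtype_mk ?_ _
    fun_prop
  have h0 : f 0 = z := by ext; simp [f]
  have hev : ∀ᶠ t in nhds (0 : ℝ), f t ∈ ((↑) ⁻¹' (R : Set V) : Set (affineSpan ℝ (R : Set V))) :=
    hf.continuousAt.eventually (by rw [h0]; exact mem_interior_iff_mem_nhds.1 hz)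
  obtain ⟨t, ht, ht0⟩ := ((hev.filter_mono nhdsWithin_le_nhds).and
    (self_mem_nhdsWithin (s := Ioi (0 : ℝ)))).exists
  exact ⟨t, ht0, ht⟩

theorem add_mem_algInterior (hx : x ∈ R.algInterior) (hy : y ∈ R) : x + y ∈ R.algInterior := by
  refine ⟨R.add_mem hx.1 hy, fun z hz => ?_⟩
  obtain ⟨ε, hε, h⟩ := hx.2 z hz
  exact ⟨ε, hε, by simpa [add_sub_right_comm] using R.add_mem h hy⟩

/-- The point `x` is the sum of `ε • y` and `x - ε • y`, both in `Y`, so the face property puts `y`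
in `F`. -/
theorem IsFaceOf.le_of_mem_algInterior (hF : F.IsFaceOf Y) (hR : R ≤ Y)
    (hx : x ∈ R.algInterior) (hxF : x ∈ F) : R ≤ F := by
  intro y hy
  obtain ⟨ε, hε, h⟩ := hx.2 y hy
  exact hF.mem_of_smul_add_mem (hR hy) (hR h) hε (by simpa using hxF)

end PointedCone

/-- Finitely many strict inequalities survive a small perturbation. -/
theorem exists_pos_forall_add_mul_pos {ι : Type*} [Finite ι] (a b : ι → ℝ) :
    ∃ ε : ℝ, 0 < ε ∧ ∀ i, 0 < a i → 0 < a i + ε * b i := by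
  have h : ∀ᶠ ε : ℝ in nhds 0, ∀ i, 0 < a i → 0 < a i + ε * b i := by
    refine Filter.eventually_all.2 fun i => Filter.eventually_imp_distrib_left.2 fun hi => ?_
    have hc : Continuous fun ε : ℝ => a i + ε * b i := by fun_prop
    exact hc.continuousAt.eventually_mem (isOpen_Ioi.mem_nhds (by simpa using hi))
  obtain ⟨ε, h1, h2⟩ := ((h.filter_mono nhdsWithin_le_nhds).and
    (self_mem_nhdsWithin (s := Ioi (0 : ℝ)))).exists
  exact ⟨ε, h2, h1⟩

/-! ### Simple reflections and words -/

namespace LinearCoxeterSystem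

variable {ι 𝔥 : Type*} [AddCommGroup 𝔥] [Module ℝ 𝔥] (L : LinearCoxeterSystem ι 𝔥)

theorem mem_chamber {x : Dual ℝ 𝔥} : x ∈ L.chamber ↔ ∀ i, 0 ≤ x (L.coroot i) :=
  mem_closedChamber _ _

theorem simple_apply (i : ι) (x : Dual ℝ 𝔥) :
    L.simple i x = x - x (L.coroot i) • L.root i :=
  rayReflection_apply _ _ _ _

theorem simple_apply_apply (i : ι) (x : Dual ℝ 𝔥) (v : 𝔥) :
    L.simple i x v = x v - x (L.coroot i) * L.root i v := by
  simp [simple_apply]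

theorem simple_apply_coroot (i : ι) (x : Dual ℝ 𝔥) :
    L.simple i x (L.coroot i) = -x (L.coroot i) := by
  rw [simple_apply_apply, L.root_coroot_two]; ring

theorem simple_apply_of_eq_zero {i : ι} {x : Dual ℝ 𝔥} (h : x (L.coroot i) = 0) :
    L.simple i x = x := by
  simp [simple_apply, h]

theorem simple_apply_eq_self_iff {i : ι} {x : Dual ℝ 𝔥} :
    L.simple i x = x ↔ x (L.coroot i) = 0 := by
  refine ⟨fun h => ?_, L.simple_apply_of_eq_zero⟩
  have := L.simple_apply_coroot i x
  rw [h] at this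
  linarith

theorem simple_simple (i : ι) (x : Dual ℝ 𝔥) : L.simple i (L.simple i x) = x := by
  rw [L.simple_apply i (L.simple i x), simple_apply_coroot, simple_apply]; module

theorem simple_mul_self (i : ι) : L.simple i * L.simple i = 1 :=
  LinearEquiv.ext fun x => L.simple_simple i x

theorem simple_inv (i : ι) : (L.simple i)⁻¹ = L.simple i :=
  inv_eq_of_mul_eq_one_left (L.simple_mul_self i)

theorem simple_mem_group (i : ι) : L.simple i ∈ L.group :=
  Subgroup.subset_closure (mem_range_self i)

theorem simple_mem_parabolic {i : ι} {J : Set ι} (hi : i ∈ J) : L.simple i ∈ L.parabolic J :=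
  Subgroup.subset_closure (mem_image_of_mem _ hi)

theorem parabolic_mono {J K : Set ι} (h : J ⊆ K) : L.parabolic J ≤ L.parabolic K :=
  Subgroup.closure_mono (image_mono h)

theorem parabolic_le_group (J : Set ι) : L.parabolic J ≤ L.group :=
  Subgroup.closure_mono (image_subset_range _ _)

/-- A standard parabolic subgroup fixes the points on all of its walls. -/
theorem apply_eq_self_of_mem_parabolic {J : Set ι} {w : Dual ℝ 𝔥 ≃ₗ[ℝ] Dual ℝ 𝔥}
    (hw : w ∈ L.parabolic J) {x : Dual ℝ 𝔥} (hx : ∀ i ∈ J, x (L.coroot i) = 0) : w x = x := by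
  have : L.parabolic J ≤ MulAction.stabilizer (Dual ℝ 𝔥 ≃ₗ[ℝ] Dual ℝ 𝔥) x := by
    refine (Subgroup.closure_le _).2 ?_
    rintro _ ⟨i, hi, rfl⟩
    exact L.simple_apply_of_eq_zero (hx i hi)
  exact this hw

/-- The product of the simple reflections of a word. -/
def word (l : List ι) : Dual ℝ 𝔥 ≃ₗ[ℝ] Dual ℝ 𝔥 :=
  (l.map L.simple).prod

@[simp] theorem word_nil : L.word [] = 1 := rfl

@[simp] theorem word_cons (i : ι) (l : List ι) : L.word (i :: l) = L.simple i * L.word l := by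
  simp [word]

@[simp] theorem word_append (l m : List ι) : L.word (l ++ m) = L.word l * L.word m := by
  simp [word]

theorem word_mem_group (l : List ι) : L.word l ∈ L.group := by
  induction l with
  | nil => exact L.group.one_mem
  | cons i l ih => rw [word_cons]; exact L.group.mul_mem (L.simple_mem_group i) ih

theorem exists_eq_word {w : Dual ℝ 𝔥 ≃ₗ[ℝ] Dual ℝ 𝔥} (hw : w ∈ L.group) :
    ∃ l, w = L.word l := by
  induction hw using Subgroup.closure_induction with
  | mem x hx => obtain ⟨i, rfl⟩ := hx; exact ⟨[i], by simp⟩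
  | one => exact ⟨[], rfl⟩
  | mul x y _ _ hx hy =>
    obtain ⟨l, rfl⟩ := hx
    obtain ⟨m, rfl⟩ := hy
    exact ⟨l ++ m, by simp⟩
  | inv x _ hx =>
    obtain ⟨l, rfl⟩ := hx
    refine ⟨l.reverse, ?_⟩
    induction l with
    | nil => simp
    | cons i l ih => simp [mul_inv_rev, simple_inv, ih (L.word_mem_group l)]

/-! ### The fundamental chamber and its facets -/

section Chamber

theorem add_mem_openChamber {x y : Dual ℝ 𝔥} (hx : x ∈ L.chamber)
    (hy : y ∈ openChamber L.coroot) : x + y ∈ openChamber L.coroot := fun i => by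
  have := L.mem_chamber.1 hx i
  have := hy i
  simp only [LinearMap.add_apply]; linarith

theorem smul_mem_openChamber {x : Dual ℝ 𝔥} {a : ℝ} (ha : 0 < a)
    (hx : x ∈ openChamber L.coroot) : a • x ∈ openChamber L.coroot := fun i => by
  have := hx i
  simp only [LinearMap.smul_apply, smul_eq_mul]; positivity

theorem mem_chamber_of_mem_openChamber {x : Dual ℝ 𝔥} (hx : x ∈ openChamber L.coroot) :
    x ∈ L.chamber :=
  L.mem_chamber.2 fun i => (hx i).le

variable [Finite ι]

/-- A convex cone in the closed chamber has a point which lies on a wall only if the cone does. -/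
theorem exists_mem_generic {K : PointedCone ℝ (Dual ℝ 𝔥)} (hK : K ≤ L.chamber) :
    ∃ x ∈ K, ∀ i, (∃ y ∈ K, 0 < y (L.coroot i)) → 0 < x (L.coroot i) := by
  classical
  have := Fintype.ofFinite ι
  have h : ∀ i, ∃ x ∈ K, (∃ y ∈ K, 0 < y (L.coroot i)) → 0 < x (L.coroot i) := fun i => by
    by_cases hi : ∃ y ∈ K, 0 < y (L.coroot i)
    · obtain ⟨y, hy, hy'⟩ := hi
      exact ⟨y, hy, fun _ => hy'⟩
    · exact ⟨0, K.zero_mem, fun h => absurd h hi⟩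
  choose f hf hf' using h
  refine ⟨∑ i, f i, sum_mem fun i _ => hf i, fun i hi => ?_⟩
  rw [LinearMap.sum_apply]
  exact Finset.sum_pos' (fun j _ => L.mem_chamber.1 (hK (hf j)) i)
    ⟨i, Finset.mem_univ i, hf' i hi⟩

/-- Otherwise some wall contains the whole closed chamber, hence its span `𝔥*`, contradicting `α i
(h i) = 2`. -/
theorem openChamber_nonempty : (openChamber L.coroot).Nonempty := by
  obtain ⟨x, -, hx⟩ := L.exists_mem_generic le_rfl
  refine ⟨x, fun i => hx i ?_⟩
  by_contra! hi
  have hle : Submodule.span ℝ (closedChamber L.coroot : Set (Dual ℝ 𝔥)) ≤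
      LinearMap.ker (Dual.eval ℝ 𝔥 (L.coroot i)) :=
    Submodule.span_le.2 fun y hy => le_antisymm (hi y hy) (L.mem_chamber.1 hy i)
  rw [L.span_chamber] at hle
  have : L.root i (L.coroot i) = 0 := hle Submodule.mem_top
  rw [L.root_coroot_two] at this
  norm_num at this

/-- Every wall of the chamber has a point which lies on no other wall. -/
theorem exists_mem_facet [FiniteDimensional ℝ 𝔥] (i : ι) :
    ∃ p : Dual ℝ 𝔥, p (L.coroot i) = 0 ∧ ∀ j, j ≠ i → 0 < p (L.coroot j) := by
  have hdim : ∀ i, finrank ℝ (Submodule.span ℝ ((closedChamber L.coroot : Set (Dual ℝ 𝔥)) ∩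
      {l : Dual ℝ 𝔥 | l (L.coroot i) = 0})) + 1 = finrank ℝ (Dual ℝ 𝔥) := fun i => by
    obtain ⟨F, -, -, h⟩ := L.bijOn_facets.mapsTo (mem_univ i)
    exact h
  obtain ⟨F, -, hF, -⟩ := L.bijOn_facets.mapsTo (mem_univ i)
  simp only at hF
  have hFC : F ≤ L.chamber := fun x hx => by
    have : x ∈ (F : Set (Dual ℝ 𝔥)) := hx
    rw [hF] at this
    exact this.1
  obtain ⟨p, hp, hp'⟩ := L.exists_mem_generic hFC
  have hp0 : p ∈ (F : Set (Dual ℝ 𝔥)) := hp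
  rw [hF] at hp0
  refine ⟨p, hp0.2, fun j hj => hp' j ?_⟩
  -- Otherwise facet `i` is contained in facet `j`. Having equal dimension, they have the same span,
  -- so facet `j` lies on wall `i` too and the facets coincide.
  by_contra! hall
  refine hj (L.bijOn_facets.injOn (mem_univ j) (mem_univ i) ?_)
  have hsub : (closedChamber L.coroot : Set (Dual ℝ 𝔥)) ∩ {l : Dual ℝ 𝔥 | l (L.coroot i) = 0} ⊆
      (closedChamber L.coroot : Set (Dual ℝ 𝔥)) ∩ {l : Dual ℝ 𝔥 | l (L.coroot j) = 0} := by
    intro y hy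
    refine ⟨hy.1, le_antisymm (hall y ?_) (L.mem_chamber.1 hy.1 j)⟩
    rw [← hF] at hy
    exact hy
  have hspan := Submodule.eq_of_le_of_finrank_eq (Submodule.span_mono (R := ℝ) hsub)
    (by have := hdim i; have := hdim j; omega)
  refine Subset.antisymm (fun y hy => ⟨hy.1, ?_⟩) hsub
  have hy' := Submodule.subset_span (R := ℝ) hy
  rw [← hspan] at hy'
  have hle : Submodule.span ℝ ((closedChamber L.coroot : Set (Dual ℝ 𝔥)) ∩
      {l : Dual ℝ 𝔥 | l (L.coroot i) = 0}) ≤ LinearMap.ker (Dual.eval ℝ 𝔥 (L.coroot i)) :=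
    Submodule.span_le.2 fun z hz => hz.2
  exact hle hy'

end Chamber

/-! ### Sides of walls, the exchange condition and the fundamental domain -/

/-- The chamber `w C` lies on the positive side of the wall of `i`. -/
def Pos (w : Dual ℝ 𝔥 ≃ₗ[ℝ] Dual ℝ 𝔥) (i : ι) : Prop :=
  ∀ x ∈ openChamber L.coroot, 0 < w x (L.coroot i)

/-- The chamber `w C` lies on the negative side of the wall of `i`. -/
def Neg (w : Dual ℝ 𝔥 ≃ₗ[ℝ] Dual ℝ 𝔥) (i : ι) : Prop :=
  ∀ x ∈ openChamber L.coroot, w x (L.coroot i) < 0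

variable {L} {w u : Dual ℝ 𝔥 ≃ₗ[ℝ] Dual ℝ 𝔥} {i k : ι} {x : Dual ℝ 𝔥}

/-- An element of `W` that maps a point of the open chamber to the open chamber is trivial. -/
theorem eq_one_of_mem_openChamber (hw : w ∈ L.group) (hx : x ∈ openChamber L.coroot)
    (hwx : w x ∈ openChamber L.coroot) : w = 1 := by
  by_contra h
  exact disjoint_left.1 (L.disjoint_smul w hw h) (smul_mem_smul_set hx) hwx

/-- If `w x` were on the wall of `i`, then `w⁻¹ σ_i w` would fix the point `x` of the open chamber
and be trivial, although `σ_i` negates `α i`. -/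
theorem apply_coroot_ne_zero (hw : w ∈ L.group) (hx : x ∈ openChamber L.coroot) (i : ι) :
    w x (L.coroot i) ≠ 0 := by
  intro h
  have h1 : w⁻¹ * L.simple i * w = 1 := by
    refine eq_one_of_mem_openChamber
      (mul_mem (mul_mem (inv_mem hw) (L.simple_mem_group i)) hw) hx ?_
    have : (w⁻¹ * L.simple i * w) x = w⁻¹ (L.simple i (w x)) := rfl
    rw [this, L.simple_apply_of_eq_zero h]
    simpa using hx
  have h2 : L.simple i = 1 := by
    have := congrArg (fun g => w * g * w⁻¹) h1
    simpa [mul_assoc] using this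
  have h3 := L.simple_apply_coroot i (L.root i)
  rw [h2, LinearEquiv.coe_one, id, L.root_coroot_two] at h3
  norm_num at h3

/-- Two points of `C` with images on opposite sides have a positive combination whose image is on
the wall. -/
theorem pos_or_neg [Finite ι] (hw : w ∈ L.group) (i : ι) : L.Pos w i ∨ L.Neg w i := by
  by_contra! h
  simp only [Pos, Neg, not_forall, not_lt] at h
  obtain ⟨⟨x, hx, hx'⟩, y, hy, hy'⟩ := h
  have hx0 := lt_of_le_of_ne hx' (apply_coroot_ne_zero hw hx i)
  have hy0 := lt_of_le_of_ne hy' (apply_coroot_ne_zero hw hy i).symm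
  refine apply_coroot_ne_zero hw (L.add_mem_openChamber (L.mem_chamber_of_mem_openChamber
    (L.smul_mem_openChamber hy0 hx)) (L.smul_mem_openChamber (neg_pos.2 hx0) hy)) i ?_
  simp only [map_add, map_smul, LinearMap.add_apply, LinearMap.smul_apply, smul_eq_mul]
  ring

theorem neg_iff_pos_simple_mul : L.Neg w i ↔ L.Pos (L.simple i * w) i := by
  simp [Neg, Pos, simple_apply_coroot]

section

variable [Finite ι]

theorem Pos.nonneg (h : L.Pos w i) (hx : x ∈ L.chamber) : 0 ≤ w x (L.coroot i) := by
  obtain ⟨c, hc⟩ := L.openChamber_nonempty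
  by_contra! hneg
  have hcp := h c hc
  -- The multiple of `c` is chosen so that the image of the sum lies exactly on the wall.
  have := h _ (L.add_mem_openChamber hx (L.smul_mem_openChamber
    (div_pos (neg_pos.2 hneg) hcp) hc))
  simp only [map_add, map_smul, LinearMap.add_apply, LinearMap.smul_apply, smul_eq_mul] at this
  rw [div_mul_cancel₀ _ hcp.ne'] at this
  linarith

theorem Neg.nonpos (h : L.Neg w i) (hx : x ∈ L.chamber) : w x (L.coroot i) ≤ 0 := by
  have := (neg_iff_pos_simple_mul.1 h).nonneg hx
  simpa [simple_apply_coroot] using this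

/-- If `u C` and `u σ_k C` lie on different sides of the wall of `i`, then this wall is the one
that separates them. -/
theorem simple_mul_eq_mul_simple [FiniteDimensional ℝ 𝔥] (hu : u ∈ L.group) (h1 : L.Pos u i)
    (h2 : L.Neg (u * L.simple k) i) : L.simple i * u = u * L.simple k := by
  obtain ⟨p, hpk, hp⟩ := L.exists_mem_facet k
  have hpC : p ∈ L.chamber := L.mem_chamber.2 fun j => by
    by_cases hj : j = k
    · rw [hj, hpk]
    · exact (hp j hj).le
  have hup : u p (L.coroot i) = 0 := by
    have a := h1.nonneg hpC
    have b := h2.nonpos hpC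
    rw [LinearEquiv.mul_apply, L.simple_apply_of_eq_zero hpk] at b
    exact le_antisymm b a
  -- Since `p` lies on wall `k` only, a small move from `p` along that wall stays in the chamber.
  -- Applied to `v` and `-v`, this makes `v ↦ (u v) (h i)` vanish on wall `k`, so it is a multiple
  -- of evaluation at `h k`.
  have hnn : ∀ v : Dual ℝ 𝔥, v (L.coroot k) = 0 → 0 ≤ u v (L.coroot i) := by
    intro v hv
    obtain ⟨ε, hε, h⟩ := exists_pos_forall_add_mul_pos (fun j => p (L.coroot j))
      (fun j => v (L.coroot j))
    have hmem : p + ε • v ∈ L.chamber := L.mem_chamber.2 fun j => by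
      simp only [LinearMap.add_apply, LinearMap.smul_apply, smul_eq_mul]
      by_cases hj : j = k
      · rw [hj, hpk, hv]; simp
      · exact (h j (hp j hj)).le
    have := h1.nonneg hmem
    simp only [map_add, map_smul, LinearMap.add_apply, LinearMap.smul_apply, smul_eq_mul, hup,
      zero_add] at this
    exact nonneg_of_mul_nonneg_right this hε
  have hzero : ∀ v : Dual ℝ 𝔥, v (L.coroot k) = 0 → u v (L.coroot i) = 0 := by
    intro v hv
    have a := hnn v hv
    have b := hnn (-v) (by simp [hv])
    simp only [map_neg, LinearMap.neg_apply] at b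
    linarith
  have hf : ∀ v : Dual ℝ 𝔥,
      u v (L.coroot i) = v (L.coroot k) * (u (L.root k) (L.coroot i) / 2) := by
    intro v
    have := hzero (v - (v (L.coroot k) / 2) • L.root k) (by simp [L.root_coroot_two])
    simp only [map_sub, map_smul, LinearMap.sub_apply, LinearMap.smul_apply, smul_eq_mul] at this
    linarith
  obtain ⟨c, hc⟩ := L.openChamber_nonempty
  have hd : 0 < u (L.root k) (L.coroot i) / 2 := by
    have := h1 c hc
    rw [hf] at this
    exact pos_of_mul_pos_right this (hc k).le
  -- It suffices that `g = 1`: it fixes `p` and keeps `c` on the positive side of wall `k`, so for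
  -- small `ε` it maps `p + ε • c` within the open chamber.
  set g := u⁻¹ * L.simple i * u * L.simple k with hg
  have hgm : g ∈ L.group := mul_mem (mul_mem (mul_mem (inv_mem hu) (L.simple_mem_group i)) hu)
    (L.simple_mem_group k)
  have hgp : g p = p := by
    change u⁻¹ (L.simple i (u (L.simple k p))) = p
    rw [L.simple_apply_of_eq_zero hpk, L.simple_apply_of_eq_zero hup]
    exact u.symm_apply_apply p
  have hgc : 0 < g c (L.coroot k) := by
    have e1 : u (g c) = L.simple i (u (L.simple k c)) := u.apply_symm_apply _
    have e2 := hf (g c)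
    rw [e1, simple_apply_coroot, hf, simple_apply_coroot] at e2
    have := hc k
    have e3 : c (L.coroot k) = g c (L.coroot k) := by
      apply mul_right_cancel₀ hd.ne'
      linarith
    rwa [← e3]
  obtain ⟨ε, hε, h⟩ := exists_pos_forall_add_mul_pos (fun j => p (L.coroot j))
    (fun j => g c (L.coroot j))
  have hg1 : g = 1 := by
    refine eq_one_of_mem_openChamber hgm
      (L.add_mem_openChamber hpC (L.smul_mem_openChamber hε hc)) fun j => ?_
    rw [map_add, map_smul, hgp]
    simp only [LinearMap.add_apply, LinearMap.smul_apply, smul_eq_mul]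
    by_cases hj : j = k
    · rw [hj, hpk, zero_add]
      exact mul_pos hε hgc
    · exact h j (hp j hj)
  have : u * g * L.simple k = L.simple i * u := by
    rw [hg]
    simp only [mul_assoc, simple_mul_self, mul_inv_cancel_left, mul_one]
  rw [← this, hg1, mul_one]

/-- If `w C` lies on the positive side of all walls, then `w = 1`. -/
theorem eq_one_of_forall_not_neg (hw : w ∈ L.group) (h : ∀ i, ¬ L.Neg w i) : w = 1 := by
  obtain ⟨c, hc⟩ := L.openChamber_nonempty
  exact eq_one_of_mem_openChamber hw hc fun i =>
    (pos_or_neg hw i).resolve_right (h i) c hc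

variable [FiniteDimensional ℝ 𝔥]

/-- The exchange condition. -/
theorem exists_word_of_neg (l : List ι) (h : L.Neg (L.word l) i) :
    ∃ m : List ι, m.length < l.length ∧ L.simple i * L.word l = L.word m := by
  induction l using List.reverseRecOn with
  | nil =>
    obtain ⟨c, hc⟩ := L.openChamber_nonempty
    exact absurd (hc i) (not_lt.2 (h c hc).le)
  | append_singleton l k ih =>
    rw [word_append, word_cons, word_nil, mul_one] at h ⊢
    -- Either the last letter crosses wall `i` and can be deleted, or an earlier letter does.
    rcases pos_or_neg (L.word_mem_group l) i with hp | hn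
    · refine ⟨l, by simp, ?_⟩
      rw [← mul_assoc, simple_mul_eq_mul_simple (L.word_mem_group l) hp h, mul_assoc,
        simple_mul_self, mul_one]
    · obtain ⟨m, hm, hm'⟩ := ih hn
      exact ⟨m ++ [k], by simpa using hm, by simp [← hm', mul_assoc]⟩

/-- Induction over `W`: the word length drops when multiplying by a simple reflection whose wall
separates `C` and `w C`. -/
theorem group_induction {P : (Dual ℝ 𝔥 ≃ₗ[ℝ] Dual ℝ 𝔥) → Prop}
    (hP : ∀ w ∈ L.group, (∀ i, L.Neg w i → P (L.simple i * w)) → P w) (hw : w ∈ L.group) :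
    P w := by
  obtain ⟨l, rfl⟩ := L.exists_eq_word hw
  induction hn : l.length using Nat.strong_induction_on generalizing l with
  | _ n ih =>
    refine hP _ hw fun i hi => ?_
    obtain ⟨m, hm, h⟩ := exists_word_of_neg l hi
    rw [h]
    exact ih _ (hn ▸ hm) m (L.word_mem_group m) rfl

/-- The closed chamber is a fundamental domain, and the stabilizers of its points are standard
parabolic subgroups. -/
theorem apply_eq_self_and_mem_parabolic (hw : w ∈ L.group) (hx : x ∈ L.chamber)
    (hwx : w x ∈ L.chamber) : w x = x ∧ w ∈ L.parabolic {i | x (L.coroot i) = 0} := by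
  revert hwx
  refine group_induction (P := fun w => w x ∈ L.chamber →
    w x = x ∧ w ∈ L.parabolic {i | x (L.coroot i) = 0}) ?_ hw
  intro w hw ih hwx
  by_cases h : ∃ i, L.Neg w i
  · obtain ⟨i, hi⟩ := h
    have h0 : w x (L.coroot i) = 0 := le_antisymm (hi.nonpos hx) (L.mem_chamber.1 hwx i)
    have hs : (L.simple i * w) x = w x := L.simple_apply_of_eq_zero h0
    obtain ⟨h1, h2⟩ := ih i hi (hs ▸ hwx)
    rw [hs] at h1
    refine ⟨h1, ?_⟩
    have : L.simple i * (L.simple i * w) = w := by rw [← mul_assoc, simple_mul_self, one_mul]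
    rw [← this]
    exact mul_mem (L.simple_mem_parabolic (by simpa [h1] using h0)) h2
  · rw [eq_one_of_forall_not_neg hw (not_exists.1 h)]
    exact ⟨rfl, one_mem _⟩

/-- Reflecting in walls of `J` that have `w C` on their negative side lowers the word length, so the
process stops. -/
theorem exists_parabolic_mul_pos (J : Set ι) (hw : w ∈ L.group) :
    ∃ u ∈ L.parabolic J, ∀ j ∈ J, L.Pos (u * w) j := by
  refine group_induction (P := fun w => ∃ u ∈ L.parabolic J, ∀ j ∈ J, L.Pos (u * w) j) ?_ hw
  intro w hw ih
  by_cases h : ∃ j ∈ J, L.Neg w j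
  · obtain ⟨j, hj, hn⟩ := h
    obtain ⟨u, hu, hu'⟩ := ih j hn
    exact ⟨u * L.simple j, mul_mem hu (L.simple_mem_parabolic hj), by simpa [mul_assoc] using hu'⟩
  · push Not at h
    exact ⟨1, one_mem _, fun j hj => by simpa using (pos_or_neg hw j).resolve_right (h j hj)⟩

/-- Up to the stabilizer of a point `x` of the closed chamber, every direction of the Tits cone
points from `x` into the closed chamber. -/
theorem exists_add_smul_mem_chamber (hx : x ∈ L.chamber) {y : Dual ℝ 𝔥} (hy : y ∈ L.titsCone) :
    ∃ u ∈ L.parabolic {i | x (L.coroot i) = 0}, ∃ ε : ℝ, 0 < ε ∧ x + ε • u y ∈ L.chamber := by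
  obtain ⟨w, hw, z, hz, rfl⟩ := mem_iUnion₂.1 hy
  obtain ⟨u, hu, hpos⟩ := exists_parabolic_mul_pos {i | x (L.coroot i) = 0} hw
  obtain ⟨ε, hε, h⟩ := exists_pos_forall_add_mul_pos (fun j => x (L.coroot j))
    (fun j => u (w z) (L.coroot j))
  refine ⟨u, hu, ε, hε, L.mem_chamber.2 fun j => ?_⟩
  change 0 ≤ x (L.coroot j) + ε * u (w z) (L.coroot j)
  -- Walls through `x` are handled by the choice of `u`, the others by the choice of `ε`.
  rcases (L.mem_chamber.1 hx j).eq_or_lt with h0 | h0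
  · rw [← h0, zero_add]
    exact mul_nonneg hε.le ((hpos j h0.symm).nonneg hz)
  · exact (h j h0).le

end

end LinearCoxeterSystem

/-! ### Types of faces and moving points into the chamber -/

namespace LinearCoxeterSystem

variable {ι 𝔥 : Type*} [AddCommGroup 𝔥] [Module ℝ 𝔥] {L : LinearCoxeterSystem ι 𝔥}
  {w : Dual ℝ 𝔥 ≃ₗ[ℝ] Dual ℝ 𝔥} {i j : ι} {x : Dual ℝ 𝔥} {R Y : PointedCone ℝ (Dual ℝ 𝔥)}

/-- Take `p` on wall `i` only and `q` on wall `j` only. Evaluating at `p` decides on which side of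
wall `j` the chambers `σ_i C` and `σ_i σ_j C` lie; evaluating at `q` then gives `α i (h j) ≤ 0` and
`α i (h j) ≥ 0`. -/
theorem root_coroot_eq_zero [Finite ι] [FiniteDimensional ℝ 𝔥] (hij : i ≠ j)
    (h : L.root j (L.coroot i) = 0) : L.root i (L.coroot j) = 0 := by
  have hmem : ∀ k, ∃ p ∈ L.chamber, p (L.coroot k) = 0 ∧ ∀ j, j ≠ k → 0 < p (L.coroot j) := by
    intro k
    obtain ⟨p, h0, hp⟩ := L.exists_mem_facet k
    refine ⟨p, L.mem_chamber.2 fun j => ?_, h0, hp⟩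
    by_cases hj : j = k
    · rw [hj, h0]
    · exact (hp j hj).le
  obtain ⟨p, hpC, hp0, hp⟩ := hmem i
  obtain ⟨q, hqC, hq0, hq⟩ := hmem j
  have hpj := hp j hij.symm
  have hqi := hq i hij
  have hle : L.root i (L.coroot j) ≤ 0 := by
    have hpos : L.Pos (L.simple i) j := (pos_or_neg (L.simple_mem_group i) j).resolve_right
      fun hn => by
        have := hn.nonpos hpC
        rw [simple_apply_apply, hp0] at this
        linarith
    have := hpos.nonneg hqC
    rw [simple_apply_apply, hq0] at this
    nlinarith
  have hge : 0 ≤ L.root i (L.coroot j) := by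
    have hval : ∀ z : Dual ℝ 𝔥, (L.simple i * L.simple j) z (L.coroot j) =
        -z (L.coroot j) - z (L.coroot i) * L.root i (L.coroot j) := fun z => by
      rw [LinearEquiv.mul_apply, simple_apply_apply, simple_apply_coroot, simple_apply_apply, h]
      ring
    have hneg : L.Neg (L.simple i * L.simple j) j :=
      (pos_or_neg (mul_mem (L.simple_mem_group i) (L.simple_mem_group j)) j).resolve_left
        fun hn => by
          have := hn.nonneg hpC
          rw [hval, hp0] at this
          linarith
    have := hneg.nonpos hqC
    rw [hval, hq0] at this
    nlinarith
  exact le_antisymm hle hge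

theorem simple_commute [Finite ι] [FiniteDimensional ℝ 𝔥] (hij : i ≠ j)
    (h : L.root j (L.coroot i) = 0) : Commute (L.simple i) (L.simple j) := by
  have h' := root_coroot_eq_zero hij h
  refine LinearEquiv.ext fun x => ?_
  simp only [LinearEquiv.mul_apply, simple_apply, LinearMap.sub_apply, LinearMap.smul_apply,
    h, h', smul_eq_mul, mul_zero, sub_zero]
  abel

theorem mem_lowerType : i ∈ L.lowerType R ↔ ∀ x ∈ R, x (L.coroot i) = 0 :=
  forall₂_congr fun _ _ => L.simple_apply_eq_self_iff

theorem lowerType_subset_typeMap : L.lowerType R ⊆ L.typeMap R := fun i hi => by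
  have : (fun x => L.simple i • x) '' (R : Set (Dual ℝ 𝔥)) = id '' (R : Set (Dual ℝ 𝔥)) :=
    image_congr fun x hx => hi x hx
  rwa [image_id] at this

theorem lowerType_anti {R' : PointedCone ℝ (Dual ℝ 𝔥)} (h : R ≤ R') :
    L.lowerType R' ⊆ L.lowerType R := fun _ hi x hx => hi x (h hx)

theorem mem_stabilizer : w ∈ L.stabilizer R ↔
    w ∈ L.group ∧ w • (R : Set (Dual ℝ 𝔥)) = (R : Set (Dual ℝ 𝔥)) :=
  Iff.rfl

theorem parabolic_typeMap_le_stabilizer : L.parabolic (L.typeMap R) ≤ L.stabilizer R := by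
  refine (Subgroup.closure_le _).2 ?_
  rintro _ ⟨i, hi, rfl⟩
  exact mem_stabilizer.2 ⟨L.simple_mem_group i, hi⟩

/-- Some `x ∈ R` is off wall `j`. Both `x` and `σ_j x` lie in `R`, hence on wall `i`, and so does
their difference, a nonzero multiple of `α j`. -/
theorem root_coroot_eq_zero_of_mem_types (hi : i ∈ L.lowerType R) (hj : j ∈ L.upperType R) :
    L.root j (L.coroot i) = 0 := by
  have hj2 := hj.2
  rw [mem_lowerType] at hi hj2
  push Not at hj2
  obtain ⟨x, hx, hxj⟩ := hj2
  have hmem : L.simple j x ∈ R := by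
    have := smul_mem_smul_set (a := L.simple j) (show x ∈ (R : Set (Dual ℝ 𝔥)) from hx)
    rwa [show L.simple j • (R : Set (Dual ℝ 𝔥)) = R from hj.1] at this
  have := hi _ hmem
  rw [simple_apply_apply, hi x hx] at this
  simpa [hxj] using this

/-- Upper and lower generators commute, so the letters of a word can be sorted. -/
theorem exists_eq_mul_of_mem_parabolic_typeMap [Finite ι] [FiniteDimensional ℝ 𝔥]
    (hw : w ∈ L.parabolic (L.typeMap R)) :
    ∃ a ∈ L.parabolic (L.upperType R), ∃ b ∈ L.parabolic (L.lowerType R), w = a * b := by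
  have hcomm : ∀ i ∈ L.lowerType R, ∀ a ∈ L.parabolic (L.upperType R),
      Commute (L.simple i) a := by
    intro i hi a ha
    have : L.parabolic (L.upperType R) ≤ Subgroup.centralizer {L.simple i} := by
      refine (Subgroup.closure_le _).2 ?_
      rintro _ ⟨j, hj, rfl⟩
      refine Subgroup.mem_centralizer_singleton_iff.2 (Commute.symm ?_)
      exact simple_commute (fun h => hj.2 (h ▸ hi)) (root_coroot_eq_zero_of_mem_types hi hj)
    exact (Subgroup.mem_centralizer_singleton_iff.1 (this ha)).symm
  have hsimple : ∀ i ∈ L.typeMap R, ∀ y : Dual ℝ 𝔥 ≃ₗ[ℝ] Dual ℝ 𝔥,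
      (∃ a ∈ L.parabolic (L.upperType R), ∃ b ∈ L.parabolic (L.lowerType R), y = a * b) →
      ∃ a ∈ L.parabolic (L.upperType R), ∃ b ∈ L.parabolic (L.lowerType R),
        L.simple i * y = a * b := by
    rintro i hi y ⟨a, ha, b, hb, rfl⟩
    by_cases hl : i ∈ L.lowerType R
    · refine ⟨a, ha, L.simple i * b, mul_mem (L.simple_mem_parabolic hl) hb, ?_⟩
      rw [← mul_assoc, (hcomm i hl a ha).eq, mul_assoc]
    · exact ⟨L.simple i * a, mul_mem (L.simple_mem_parabolic ⟨hi, hl⟩) ha, b, hb,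
        (mul_assoc _ _ _).symm⟩
  induction hw using Subgroup.closure_induction_left with
  | one => exact ⟨1, one_mem _, 1, one_mem _, (one_mul 1).symm⟩
  | mul_left x hx y _ ih =>
    obtain ⟨i, hi, rfl⟩ := hx
    exact hsimple i hi y ih
  | inv_mul_cancel x hx y _ ih =>
    obtain ⟨i, hi, rfl⟩ := hx
    rw [simple_inv]
    exact hsimple i hi y ih

theorem apply_mem_of_smul_eq (h : w • (R : Set (Dual ℝ 𝔥)) = R) (hx : x ∈ R) : w x ∈ R := by
  have : w • x ∈ w • (R : Set (Dual ℝ 𝔥)) := smul_mem_smul_set hx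
  rwa [h] at this

/-- A face of `Y` with a relatively interior point fixed by `w` is `w`-invariant. -/
theorem smul_eq_of_apply_eq (hYW : ∀ w ∈ L.group, w • (Y : Set (Dual ℝ 𝔥)) = Y)
    (hR : R.IsFaceOf Y) (hx : x ∈ R.algInterior) (hw : w ∈ L.group) (hwx : w x = x) :
    w • (R : Set (Dual ℝ 𝔥)) = R := by
  have key : ∀ v ∈ L.group, v x = x → ∀ y ∈ R, v y ∈ R := by
    intro v hv hvx y hy
    obtain ⟨ε, hε, h⟩ := hx.2 y hy
    -- Applying `v` to `x = ε • y + (x - ε • y)` writes `x` as a sum of two points of `Y`; the face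
    -- property puts both in `R`.
    refine hR.mem_of_smul_add_mem (apply_mem_of_smul_eq (hYW v hv) (hR.le hy))
      (apply_mem_of_smul_eq (hYW v hv) (hR.le h)) hε ?_
    rw [map_sub, map_smul, add_sub_cancel, hvx]
    exact hx.1
  refine Subset.antisymm ?_ fun y hy => ?_
  · rintro _ ⟨y, hy, rfl⟩
    exact key w hw hwx y hy
  · refine mem_smul_set_iff_inv_smul_mem.2 (key w⁻¹ (inv_mem hw) ?_ y hy)
    exact (LinearEquiv.symm_apply_eq w).2 hwx.symm

variable [Finite ι] [FiniteDimensional ℝ 𝔥]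

/-- A face in the cross section lattice has a relatively interior point in the closed chamber
which lies only on those walls that contain the face. -/
theorem exists_mem_algInterior_generic (hYX : (Y : Set (Dual ℝ 𝔥)) ⊆ L.titsCone)
    (hYW : ∀ w ∈ L.group, w • (Y : Set (Dual ℝ 𝔥)) = Y) (hR : R.IsFaceOf Y)
    (hx : x ∈ R.algInterior) (hxC : x ∈ L.chamber) :
    ∃ z ∈ R.algInterior, z ∈ L.chamber ∧ {i | z (L.coroot i) = 0} ⊆ L.lowerType R := by
  obtain ⟨g, hg, hg'⟩ := L.exists_mem_generic (K := R ⊓ L.chamber) inf_le_right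
  refine ⟨x + g, PointedCone.add_mem_algInterior hx hg.1, add_mem hxC hg.2, ?_⟩
  -- By genericity of `g`, a wall through `x + g` contains all of `R ⊓ L.chamber`. What remains is
  -- to pass to all of `R`.
  have hzero : ∀ i, (x + g) (L.coroot i) = 0 → ∀ y ∈ R ⊓ L.chamber, y (L.coroot i) = 0 := by
    intro i hi y hy
    have h1 := L.mem_chamber.1 hxC i
    have h2 := L.mem_chamber.1 hg.2 i
    rw [LinearMap.add_apply] at hi
    refine le_antisymm (not_lt.1 fun hlt => ?_) (L.mem_chamber.1 hy.2 i)
    have := hg' i ⟨y, hy, hlt⟩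
    linarith
  have hz := PointedCone.add_mem_algInterior hx hg.1
  intro i hi
  refine mem_lowerType.2 fun y hy => ?_
  -- As `u` fixes `x + g`, it preserves `R`, so `x + g + ε • u y` lies in `R ⊓ L.chamber`. Hence `u
  -- y` is on every wall through `x + g`, is fixed by `u⁻¹`, and equals `y`.
  obtain ⟨u, hu, ε, hε, hmem⟩ :=
    exists_add_smul_mem_chamber (add_mem hxC hg.2) (hYX (hR.le hy))
  have huR : u y ∈ R := apply_mem_of_smul_eq
    (smul_eq_of_apply_eq hYW hR hz (L.parabolic_le_group _ hu)
      (L.apply_eq_self_of_mem_parabolic hu fun _ h => h)) hy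
  have hval : ∀ j, (x + g) (L.coroot j) = 0 → u y (L.coroot j) = 0 := by
    intro j hj
    have := hzero j hj _ ⟨add_mem hz.1 (R.smul_mem hε.le huR), hmem⟩
    rw [LinearMap.add_apply, hj, LinearMap.smul_apply, smul_eq_mul, zero_add] at this
    exact (mul_eq_zero.1 this).resolve_left hε.ne'
  have hfix : u⁻¹ (u y) = u y := L.apply_eq_self_of_mem_parabolic (inv_mem hu) hval
  have hy' : y = u y := (u.symm_apply_apply y).symm.trans hfix
  rw [hy']
  exact hval i hi

/-- If `w` moves a point `x` of the closed chamber into a face `R` of the cross section lattice,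
then `x` belongs to `R`, and `w` is a product of an element of `W_{υ(R)}` and an element of the
stabilizer of `x`. -/
theorem mem_and_mem_mul_of_apply_mem (hYW : ∀ w ∈ L.group, w • (Y : Set (Dual ℝ 𝔥)) = Y)
    (hR : R.IsFaceOf Y) {z : Dual ℝ 𝔥} (hz : z ∈ R.algInterior) (hzC : z ∈ L.chamber)
    (hxC : x ∈ L.chamber) (hw : w ∈ L.group) (hwx : w x ∈ R) :
    x ∈ R ∧ ∃ a ∈ L.parabolic (L.typeMap R), ∃ b ∈ L.parabolic {i | x (L.coroot i) = 0},
      w = a * b := by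
  revert hwx
  refine group_induction (P := fun w => w x ∈ R → x ∈ R ∧ ∃ a ∈ L.parabolic (L.typeMap R),
    ∃ b ∈ L.parabolic {i | x (L.coroot i) = 0}, w = a * b) ?_ hw
  intro w hw ih hwx
  by_cases hC : w x ∈ L.chamber
  · obtain ⟨h1, h2⟩ := apply_eq_self_and_mem_parabolic hw hxC hC
    exact ⟨h1 ▸ hwx, 1, one_mem _, w, h2, (one_mul w).symm⟩
  · have hne : {i | w x (L.coroot i) < 0}.Nonempty := by
      simpa [mem_chamber, Set.Nonempty] using hC
    obtain ⟨i, hi, hmin⟩ := exists_min_image _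
      (fun i => z (L.coroot i) / -w x (L.coroot i)) (toFinite _) hne
    have hi' : w x (L.coroot i) < 0 := hi
    -- For this `t ≥ 0` the ray from `z` in direction `w x` meets wall `i`. Adding `t • w x ∈ R`
    -- keeps the point interior to `R`, so `σ_i`, which fixes it, preserves `R`.
    set t := z (L.coroot i) / -w x (L.coroot i) with ht
    have ht0 : 0 ≤ t := div_nonneg (L.mem_chamber.1 hzC i) (by linarith)
    have hwall : (z + t • w x) (L.coroot i) = 0 := by
      rw [LinearMap.add_apply, LinearMap.smul_apply, smul_eq_mul, ht]
      field_simp [hi'.ne]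
      ring
    have hfix : i ∈ L.typeMap R :=
      smul_eq_of_apply_eq hYW hR (PointedCone.add_mem_algInterior hz (R.smul_mem ht0 hwx))
        (L.simple_mem_group i) (L.simple_apply_of_eq_zero hwall)
    have hneg : L.Neg w i := (pos_or_neg hw i).resolve_left fun hp =>
      absurd (hp.nonneg hxC) (not_le.2 hi')
    obtain ⟨hxR, a, ha, b, hb, hab⟩ := ih i hneg
      (apply_mem_of_smul_eq (w := L.simple i) hfix hwx)
    refine ⟨hxR, L.simple i * a, mul_mem (L.simple_mem_parabolic hfix) ha, b, hb, ?_⟩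
    rw [mul_assoc, ← hab, ← mul_assoc, simple_mul_self, one_mul]

end LinearCoxeterSystem

/-! ### Comparing translates of faces -/

namespace LinearCoxeterSystem

variable {ι 𝔥 : Type*} [AddCommGroup 𝔥] [Module ℝ 𝔥] {L : LinearCoxeterSystem ι 𝔥}
  {w : Dual ℝ 𝔥 ≃ₗ[ℝ] Dual ℝ 𝔥} {R R₁ R₂ Y : PointedCone ℝ (Dual ℝ 𝔥)}

theorem exists_mem_algInterior_of_mem_crossSection (hR : R ∈ L.crossSection Y) :
    ∃ x ∈ R.algInterior, x ∈ L.chamber := by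
  obtain ⟨-, x, hx, hxC⟩ := hR
  exact ⟨x, PointedCone.relInterior_subset_algInterior R hx, hxC⟩

theorem parabolic_mul_subset_stabilizer_mul :
    (L.parabolic (L.lowerType R₁) : Set (Dual ℝ 𝔥 ≃ₗ[ℝ] Dual ℝ 𝔥)) *
        (L.parabolic (L.upperType R₂) : Set (Dual ℝ 𝔥 ≃ₗ[ℝ] Dual ℝ 𝔥)) ⊆
      (L.stabilizer R₁ : Set (Dual ℝ 𝔥 ≃ₗ[ℝ] Dual ℝ 𝔥)) *
        (L.stabilizer R₂ : Set (Dual ℝ 𝔥 ≃ₗ[ℝ] Dual ℝ 𝔥)) :=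
  mul_subset_mul
    ((L.parabolic_mono lowerType_subset_typeMap).trans parabolic_typeMap_le_stabilizer)
    ((L.parabolic_mono sdiff_subset).trans parabolic_typeMap_le_stabilizer)

/-- For `w = a b` one has `R₁ = a R₁ ⊆ a R₂ = a b R₂`. -/
theorem subset_smul_of_mem_stabilizer_mul (h : R₁ ≤ R₂)
    (hw : w ∈ (L.stabilizer R₁ : Set (Dual ℝ 𝔥 ≃ₗ[ℝ] Dual ℝ 𝔥)) *
      (L.stabilizer R₂ : Set (Dual ℝ 𝔥 ≃ₗ[ℝ] Dual ℝ 𝔥))) :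
    (R₁ : Set (Dual ℝ 𝔥)) ⊆ w • (R₂ : Set (Dual ℝ 𝔥)) := by
  obtain ⟨a, ha, b, hb, rfl⟩ := hw
  change _ ⊆ (a * b) • (R₂ : Set (Dual ℝ 𝔥))
  rw [mul_smul, (mem_stabilizer.1 hb).2]
  nth_rw 1 [← (mem_stabilizer.1 ha).2]
  exact smul_set_mono h

variable [FiniteDimensional ℝ 𝔥]

/-- Every face of `Y` is a translate of a face in the cross section lattice. -/
theorem exists_mem_crossSection_smul (hYX : (Y : Set (Dual ℝ 𝔥)) ⊆ L.titsCone)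
    (hYW : ∀ w ∈ L.group, w • (Y : Set (Dual ℝ 𝔥)) = Y) (hR : R.IsFaceOf Y) :
    ∃ R' ∈ L.crossSection Y, ∃ w ∈ L.group,
      (R : Set (Dual ℝ 𝔥)) = w • (R' : Set (Dual ℝ 𝔥)) := by
  obtain ⟨x, hx⟩ := R.convex.relInterior_nonempty ⟨0, R.zero_mem⟩
  have hxR := (PointedCone.relInterior_subset_algInterior R hx).1
  -- An interior point of `R` lies in some `w • L.chamber`, so `w⁻¹ R` is the required face.
  obtain ⟨w, hw, z, hz, rfl⟩ := mem_iUnion₂.1 (hYX (hR.le hxR))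
  have hcoe : ((R.map (w⁻¹ : Dual ℝ 𝔥 ≃ₗ[ℝ] Dual ℝ 𝔥).toLinearMap : PointedCone ℝ (Dual ℝ 𝔥)) :
      Set (Dual ℝ 𝔥)) = w⁻¹ • (R : Set (Dual ℝ 𝔥)) := PointedCone.coe_map _ _
  have hY : Y.map (w⁻¹ : Dual ℝ 𝔥 ≃ₗ[ℝ] Dual ℝ 𝔥).toLinearMap = Y :=
    SetLike.coe_injective ((PointedCone.coe_map _ _).trans (hYW w⁻¹ (inv_mem hw)))
  refine ⟨R.map (w⁻¹ : Dual ℝ 𝔥 ≃ₗ[ℝ] Dual ℝ 𝔥).toLinearMap, ⟨?_, z, ?_, hz⟩, w, hw, ?_⟩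
  · have := hR.map_equiv w⁻¹
    rwa [hY] at this
  · have hi : relInterior (w⁻¹ • (R : Set (Dual ℝ 𝔥))) = _ := relInterior_image w⁻¹ _
    rw [hcoe, hi]
    exact ⟨w z, hx, w.symm_apply_apply z⟩
  · rw [hcoe, smul_inv_smul]

variable [Finite ι]

theorem le_and_mem_parabolic_mul_of_subset_smul (hYX : (Y : Set (Dual ℝ 𝔥)) ⊆ L.titsCone)
    (hYW : ∀ w ∈ L.group, w • (Y : Set (Dual ℝ 𝔥)) = Y) (h₁ : R₁ ∈ L.crossSection Y)
    (h₂ : R₂ ∈ L.crossSection Y) (hw : w ∈ L.group)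
    (h : (R₁ : Set (Dual ℝ 𝔥)) ⊆ w • (R₂ : Set (Dual ℝ 𝔥))) :
    R₁ ≤ R₂ ∧ w ∈ (L.parabolic (L.lowerType R₁) : Set (Dual ℝ 𝔥 ≃ₗ[ℝ] Dual ℝ 𝔥)) *
      (L.parabolic (L.upperType R₂) : Set (Dual ℝ 𝔥 ≃ₗ[ℝ] Dual ℝ 𝔥)) := by
  obtain ⟨x, hx, hxC⟩ := exists_mem_algInterior_of_mem_crossSection h₁
  obtain ⟨y, hy, hyC, hyJ⟩ := exists_mem_algInterior_generic hYX hYW h₁.1 hx hxC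
  obtain ⟨z, hz, hzC⟩ := exists_mem_algInterior_of_mem_crossSection h₂
  obtain ⟨hyR, a, ha, b, hb, hab⟩ := mem_and_mem_mul_of_apply_mem hYW h₂.1 hz hzC hyC
    (inv_mem hw) (mem_smul_set_iff_inv_smul_mem.1 (h hy.1))
  have hle : R₁ ≤ R₂ := h₂.1.le_of_mem_algInterior h₁.1.le hy hyR
  refine ⟨hle, ?_⟩
  obtain ⟨c, hc, d, hd, rfl⟩ := exists_eq_mul_of_mem_parabolic_typeMap ha
  -- Here `d` fixes `R₂` pointwise and `b` fixes `y`; both belong to the lower parabolic subgroup of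
  -- `R₁`, and `c` to the upper one of `R₂`.
  have hw' : w = (d * b)⁻¹ * c⁻¹ := by
    rw [← mul_inv_rev, ← mul_assoc, ← hab, inv_inv]
  rw [hw']
  exact mul_mem_mul (inv_mem (mul_mem (L.parabolic_mono (lowerType_anti hle) hd)
    (L.parabolic_mono hyJ hb))) (inv_mem hc)

theorem stabilizer_mul_eq_parabolic_mul (hYX : (Y : Set (Dual ℝ 𝔥)) ⊆ L.titsCone)
    (hYW : ∀ w ∈ L.group, w • (Y : Set (Dual ℝ 𝔥)) = Y) (h₁ : R₁ ∈ L.crossSection Y)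
    (h₂ : R₂ ∈ L.crossSection Y) (h : R₁ ≤ R₂) :
    (L.stabilizer R₁ : Set (Dual ℝ 𝔥 ≃ₗ[ℝ] Dual ℝ 𝔥)) *
        (L.stabilizer R₂ : Set (Dual ℝ 𝔥 ≃ₗ[ℝ] Dual ℝ 𝔥)) =
      (L.parabolic (L.lowerType R₁) : Set (Dual ℝ 𝔥 ≃ₗ[ℝ] Dual ℝ 𝔥)) *
        (L.parabolic (L.upperType R₂) : Set (Dual ℝ 𝔥 ≃ₗ[ℝ] Dual ℝ 𝔥)) := by
  refine Subset.antisymm (fun w hw => ?_) parabolic_mul_subset_stabilizer_mul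
  have hsub := subset_smul_of_mem_stabilizer_mul h hw
  obtain ⟨a, ha, b, hb, rfl⟩ := hw
  exact (le_and_mem_parabolic_mul_of_subset_smul hYX hYW h₁ h₂
    (mul_mem (mem_stabilizer.1 ha).1 (mem_stabilizer.1 hb).1) hsub).2

end LinearCoxeterSystem

open LinearCoxeterSystem

theorem mainTheorem5 {ι 𝔥 : Type*} [Finite ι] [AddCommGroup 𝔥] [Module ℝ 𝔥]
    [FiniteDimensional ℝ 𝔥] (L : LinearCoxeterSystem ι 𝔥)
    (Y : PointedCone ℝ (Dual ℝ 𝔥)) (hYX : (Y : Set (Dual ℝ 𝔥)) ⊆ L.titsCone)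
    (hYW : ∀ w ∈ L.group, w • (Y : Set (Dual ℝ 𝔥)) = Y) :
    (∀ R₁ ∈ L.crossSection Y, ∀ R₂ ∈ L.crossSection Y, ∀ w₁ ∈ L.group, ∀ w₂ ∈ L.group,
      List.TFAE [
        w₁ • (R₁ : Set (Dual ℝ 𝔥)) ⊆ w₂ • (R₂ : Set (Dual ℝ 𝔥)),
        R₁ ≤ R₂ ∧ (w₁ • (L.stabilizer R₁ : Set (Dual ℝ 𝔥 ≃ₗ[ℝ] Dual ℝ 𝔥)) ∩
          w₂ • (L.stabilizer R₂ : Set (Dual ℝ 𝔥 ≃ₗ[ℝ] Dual ℝ 𝔥))).Nonempty,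
        R₁ ≤ R₂ ∧ w₁⁻¹ * w₂ ∈ (L.stabilizer R₁ : Set (Dual ℝ 𝔥 ≃ₗ[ℝ] Dual ℝ 𝔥)) *
          (L.stabilizer R₂ : Set (Dual ℝ 𝔥 ≃ₗ[ℝ] Dual ℝ 𝔥)),
        R₁ ≤ R₂ ∧ w₁⁻¹ * w₂ ∈
          (L.parabolic (L.lowerType R₁) : Set (Dual ℝ 𝔥 ≃ₗ[ℝ] Dual ℝ 𝔥)) *
          (L.parabolic (L.upperType R₂) : Set (Dual ℝ 𝔥 ≃ₗ[ℝ] Dual ℝ 𝔥))]) ∧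
    (∀ R₁ ∈ L.crossSection Y, ∀ R₂ ∈ L.crossSection Y, R₁ ≤ R₂ →
      (L.stabilizer R₁ : Set (Dual ℝ 𝔥 ≃ₗ[ℝ] Dual ℝ 𝔥)) *
          (L.stabilizer R₂ : Set (Dual ℝ 𝔥 ≃ₗ[ℝ] Dual ℝ 𝔥)) =
        (L.parabolic (L.lowerType R₁) : Set (Dual ℝ 𝔥 ≃ₗ[ℝ] Dual ℝ 𝔥)) *
          (L.parabolic (L.upperType R₂) : Set (Dual ℝ 𝔥 ≃ₗ[ℝ] Dual ℝ 𝔥))) ∧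
    (∀ R' : PointedCone ℝ (Dual ℝ 𝔥), R'.IsFaceOf Y →
      ∃! R : PointedCone ℝ (Dual ℝ 𝔥), R ∈ L.crossSection Y ∧
        ∃ w ∈ L.group, (R' : Set (Dual ℝ 𝔥)) = w • (R : Set (Dual ℝ 𝔥))) := by
  refine ⟨fun R₁ h₁ R₂ h₂ w₁ hw₁ w₂ hw₂ => ?_,
    fun R₁ h₁ R₂ h₂ => stabilizer_mul_eq_parabolic_mul hYX hYW h₁ h₂, fun R' hR' => ?_⟩
  · have hw : w₁⁻¹ * w₂ ∈ L.group := mul_mem (inv_mem hw₁) hw₂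
    tfae_have 1 → 4 := fun h => by
      refine le_and_mem_parabolic_mul_of_subset_smul hYX hYW h₁ h₂ hw ?_
      rw [mul_smul, ← smul_set_subset_iff_subset_inv_smul_set]
      exact h
    tfae_have 4 → 3 := fun h => ⟨h.1, parabolic_mul_subset_stabilizer_mul h.2⟩
    tfae_have 3 → 2 := by
      rintro ⟨h, a, ha, b, hb, hab⟩
      refine ⟨h, w₁ * a, smul_mem_smul_set ha, mem_smul_set_iff_inv_smul_mem.2 ?_⟩
      have hb' : w₂⁻¹ * (w₁ * a) = b⁻¹ := by
        have : w₂ = w₁ * (a * b) := by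
          rw [show a * b = w₁⁻¹ * w₂ from hab, mul_inv_cancel_left]
        rw [this]
        group
      rw [smul_eq_mul, hb']
      exact inv_mem hb
    tfae_have 2 → 1 := by
      rintro ⟨h, _, ⟨a, ha, rfl⟩, b, hb, hab⟩
      have hab' : w₂ * b = w₁ * a := hab
      rw [smul_set_subset_iff_subset_inv_smul_set, ← mul_smul]
      refine subset_smul_of_mem_stabilizer_mul h ⟨a, ha, b⁻¹, inv_mem hb, ?_⟩
      change a * b⁻¹ = w₁⁻¹ * w₂
      rw [mul_inv_eq_iff_eq_mul, mul_assoc, hab', inv_mul_cancel_left]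
    tfae_finish
  · obtain ⟨R, hR, w, hw, hwR⟩ := exists_mem_crossSection_smul hYX hYW hR'
    refine ⟨R, ⟨hR, w, hw, hwR⟩, ?_⟩
    rintro S ⟨hS, v, hv, hvS⟩
    have hvw : v • (S : Set (Dual ℝ 𝔥)) = w • (R : Set (Dual ℝ 𝔥)) := hvS.symm.trans hwR
    -- An equality of translates is two inclusions, and each forces inclusion of the untranslated
    -- faces.
    refine le_antisymm ?_ ?_
    · refine (le_and_mem_parabolic_mul_of_subset_smul hYX hYW hS hR
        (mul_mem (inv_mem hv) hw) ?_).1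
      rw [mul_smul, ← hvw, inv_smul_smul]
    · refine (le_and_mem_parabolic_mul_of_subset_smul hYX hYW hR hS
        (mul_mem (inv_mem hw) hv) ?_).1
      rw [mul_smul, hvw, inv_smul_smul]
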